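/- **Conventions.** A *Clifford circuit* on $n$ qubits is a sequence of operations $C_1,\dots,C_s$ in chronological order, each of which is a Clifford unitary or the measurement of a Pauli operator ($\pm$ a tensor product of matrices $I,X,Y,Z$, not all equal to $I$). Each operation has a level in $\{1,2,\dots\}$, the levels are non-decreasing along the sequence, and distinct operations with the same level have disjoint supports. The depth $\Delta$ is the maximum level. Let $S_1,\dots,S_m$ be the measured operators and $\ell_1,\dots,\ell_m$ their levels. The *outcome code* $\mathcal O(\mathcal C)\subseteq\mathbb Z_2^m$ is the set of all outcome bit-strings that occur with non-zero probability for at least one input state, outcome $o_j$ meaning that the eigenvalue $(-1)^{o_j}$ of $S_j$ is observed. We assume that it is a linear code, and $\mathcal O(\mathcal C)^\perp$ denotes its dual. A *fault operator* is a Pauli operator $F=\bigotimes_{\ell=0}^{\Delta}F_{\ell+0.5}$ on the $n(\Delta+1)$ qubits indexed by pairs $(\ell+0.5,q)$, where $0\le \ell\le\Delta$ and $q$ is a qubit of the circuit; $\eta_{\ell+0.5}(P)$ is the fault operator whose component at $\ell+0.5$ is $P$ and whose other components are $I$. Let $U_\ell$ be the product of all unitary operations with level $\ell$. The *back-cumulant*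 $\overleftarrow F$ is defined by $\overleftarrow F_{\Delta+0.5}=F_{\Delta+0.5}$ and $$\overleftarrow F_{\ell-0.5}=F_{\ell-0.5}\cdot U_\ell^{-1}\,\overleftarrow F_{\ell+0.5}\,U_\ell,\qquad \ell=\Delta,\Delta-1,\dots,1 .$$ For $u\in\mathbb Z_2^m$ let $F(u)=\prod_{j=1}^m\eta_{\ell_j-0.5}(S_j^{u_j})$. The operators $\overleftarrow{F(u)}$ are taken with the phases given by these formulas. **Theorem (The spacetime code).** Let $\mathcal C$ be a Clifford circuit on $n$ qubits with depth $\Delta$ and $m$ measurements, whose outcome code $\mathcal O(\mathcal C)$ is linear. Then the set of all check operators $\overleftarrow{F(u)}$ for $u\in\mathcal O(\mathcal C)^\perp$ is a stabilizer group, that is, a commutative group of Pauli operators on $n(\Delta+1)$ qubits that does not contain $-I$. Moreover, if $\mathcal O(\mathcal C)$ has parameters $[m,k]$ (length $m$, dimension $k$), then the stabilizer code of this group, the *spacetime code* of $\mathcal C$, has parameters $[[N,K]]$ with $N=n(\Delta+1)$ and $K=N-(m-k)$: it has $N$ physical qubits, and its code space (the vectors fixed by every operator of the group) has dimension $2^K$.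 -/

import Mathlib

open scoped Matrix ComplexOrder

noncomputable section

namespace SpacetimeCode

/-! ### Operators and Pauli operators on a finite set of qubits -/

/-- Operators on the qubits labelled by `Q`, as matrices in the computational basis. -/
abbrev QOp (Q : Type) : Type := Matrix (Q → Fin 2) (Q → Fin 2) ℂ

/-- Labels of the four single-qubit Pauli matrices. -/
inductive Pauli
  | I
  | X
  | Y
  | Z

/-- The single-qubit Pauli matrices. -/
def Pauli.mat : Pauli → Matrix (Fin 2) (Fin 2) ℂ
  | .I => 1
  | .X => !![0, 1; 1, 0]
  | .Y => !![0, -Complex.I; Complex.I, 0]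
  | .Z => !![1, 0; 0, -1]

section Operators

variable {Q : Type} [Fintype Q] [DecidableEq Q]

/-- The tensor product of single-qubit Pauli matrices, one for each qubit. -/
def pauliString (p : Q → Pauli) : QOp Q :=
  Matrix.of fun x y => ∏ q, (p q).mat (x q) (y q)

/-- Membership in the Pauli group: a Pauli string times a phase `1`, `i`, `-1` or `-i`. -/
def IsPauli (A : QOp Q) : Prop :=
  ∃ (a : Fin 4) (p : Q → Pauli), A = Complex.I ^ (a : ℕ) • pauliString p

/-- A Pauli operator that can be measured: a sign times a Pauli string other than the identity. -/
def IsPauliObservable (A : QOp Q) : Prop :=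
  ∃ p : Q → Pauli, (∃ q, p q ≠ Pauli.I) ∧ (A = pauliString p ∨ A = -pauliString p)

/-- Clifford unitaries: unitaries that preserve the Pauli group under conjugation. -/
def IsClifford (U : QOp Q) : Prop :=
  U ∈ Matrix.unitaryGroup (Q → Fin 2) ℂ ∧ ∀ P : QOp Q, IsPauli P → IsPauli (U * P * Uᴴ)

/-- `A` is the tensor product of the identity on qubit `q` with an operator on the other qubits. -/
def ActsTriviallyOn (A : QOp Q) (q : Q) : Prop :=
  (∀ x y, x q ≠ y q → A x y = 0) ∧
    ∀ x y, x q = y q → ∀ b, A (Function.update x q b) (Function.update y q b) = A x y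

/-- The support of an operator: the qubits on which it acts non-trivially. -/
def opSupport (A : QOp Q) : Set Q := {q | ¬ ActsTriviallyOn A q}

/-- Quantum states, as density matrices. -/
def IsState (ρ : QOp Q) : Prop := ρ.PosSemidef ∧ ρ.trace = 1

/-- A stabilizer group: a commutative group of Pauli operators that does not contain `-I`. -/
structure IsStabilizerGroup (S : Subgroup (Matrix.unitaryGroup (Q → Fin 2) ℂ)) : Prop where
  pauli : ∀ g ∈ S, IsPauli (g : QOp Q)
  comm : ∀ g ∈ S, ∀ h ∈ S, g * h = h * g
  neg_one_notMem : ∀ g ∈ S, (g : QOp Q) ≠ -1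

/-- The code space: the vectors fixed by every operator of the group. -/
def codeSpace (S : Subgroup (Matrix.unitaryGroup (Q → Fin 2) ℂ)) :
    Submodule ℂ ((Q → Fin 2) → ℂ) where
  carrier := {ψ | ∀ g ∈ S, (g : QOp Q) *ᵥ ψ = ψ}
  add_mem' := by
    intro a b ha hb g hg
    rw [Matrix.mulVec_add, ha g hg, hb g hg]
  zero_mem' := by
    intro g _
    exact Matrix.mulVec_zero _
  smul_mem' := by
    intro c a ha g hg
    rw [Matrix.mulVec_smul, ha g hg]

/-- The stabilizer code of `S` has parameters `[[N, K]]`: it has `N` physical qubits and its code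
space has dimension `2 ^ K`, that is, it encodes `K` qubits. -/
def HasParameters (S : Subgroup (Matrix.unitaryGroup (Q → Fin 2) ℂ)) (N K : ℕ) : Prop :=
  Fintype.card Q = N ∧ Module.finrank ℂ (codeSpace S) = 2 ^ K

end Operators

/-- The dual of a binary code, for the inner product `∑ i, u i * v i` modulo 2. -/
def dualCode {ι : Type} [Fintype ι] (O : Submodule (ZMod 2) (ι → ZMod 2)) :
    Set (ι → ZMod 2) :=
  {u | ∀ v ∈ O, u ⬝ᵥ v = 0}

/-! ### Clifford circuits -/

/-- A Clifford operation on `n` qubits: a Clifford unitary or the measurement of a Pauli operator. -/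
inductive CliffordOp (n : ℕ)
  | gate (U : QOp (Fin n)) (hU : IsClifford U)
  | meas (S : QOp (Fin n)) (hS : IsPauliObservable S)

/-- Whether the operation is a measurement. -/
def CliffordOp.isMeas {n : ℕ} : CliffordOp n → Bool
  | .gate _ _ => false
  | .meas _ _ => true

/-- The unitary that is applied, or the Pauli operator that is measured. -/
def CliffordOp.mat {n : ℕ} : CliffordOp n → QOp (Fin n)
  | .gate U _ => U
  | .meas S _ => S

/-- A Clifford circuit on `n` qubits: operations at levels `1, 2, …` in chronological order,
those at the same level having disjoint supports. -/
structure CliffordCircuit (n : ℕ) where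
  size : ℕ
  op : Fin size → CliffordOp n
  level : Fin size → ℕ
  one_le_level : ∀ i, 1 ≤ level i
  level_mono : Monotone level
  disjoint_support : ∀ i j, i ≠ j → level i = level j →
    Disjoint (opSupport (op i).mat) (opSupport (op j).mat)

namespace CliffordCircuit

variable {n : ℕ} (C : CliffordCircuit n)

/-- The depth of a circuit: the maximum level of its operations. -/
def depth : ℕ := Finset.univ.sup C.level

theorem level_le_depth (i : Fin C.size) : C.level i ≤ C.depth :=
  Finset.le_sup (Finset.mem_univ i)

/-- The indices of the measurements of the circuit. -/
abbrev Meas : Type := {i : Fin C.size // (C.op i).isMeas = true}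

/-- The operator that operation `i` applies to the (unnormalized) state vector when the outcome
bit-string is `o`: the unitary itself for a gate, and the projector `(I + (-1) ^ o_j S_j) / 2` for
a measurement. -/
def stepOp (o : C.Meas → ZMod 2) (i : Fin C.size) : QOp (Fin n) :=
  if h : (C.op i).isMeas = true then
    (1 / 2 : ℂ) • (1 + (-1 : ℂ) ^ (o ⟨i, h⟩).val • (C.op i).mat)
  else (C.op i).mat

/-- The operator that the whole circuit applies when the outcome bit-string is `o`; the earliest
operation is the rightmost factor. -/
def runOp (o : C.Meas → ZMod 2) : QOp (Fin n) :=
  ((List.finRange C.size).reverse.map (C.stepOp o)).prod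

/-- The probability of the outcome bit-string `o` when the input state is `ρ`. -/
def outcomeProb (ρ : QOp (Fin n)) (o : C.Meas → ZMod 2) : ℝ :=
  (C.runOp o * ρ * (C.runOp o)ᴴ).trace.re

/-- The set of all possible outcome bit-strings of the circuit: those with non-zero probability
for at least one input state. -/
def outcomeSet : Set (C.Meas → ZMod 2) :=
  {o | ∃ ρ : QOp (Fin n), IsState ρ ∧ C.outcomeProb ρ o ≠ 0}

/-! ### Fault operators and back-cumulants -/

/-- The space-time qubits: `(ℓ, q)` with `0 ≤ ℓ ≤ Δ` is qubit `q` right after level `ℓ`, that is, at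
the half-integer time `ℓ + 0.5`. -/
abbrev STQubit : Type := Fin (C.depth + 1) × Fin n

/-- A fault operator, given by its `n`-qubit components: `F ℓ` is the component at the time
`ℓ + 0.5`. Phases are kept. -/
abbrev Fault : Type := Fin (C.depth + 1) → QOp (Fin n)

/-- The operator on all the space-time qubits that is the tensor product of the components. -/
def Fault.toOp {C : CliffordCircuit n} (F : C.Fault) : QOp C.STQubit :=
  Matrix.of fun x y => ∏ l, F l (fun q => x (l, q)) (fun q => y (l, q))

/-- The fault operator with component `P` at the time `l + 0.5` and `I` at all other times. -/
def eta (l : Fin (C.depth + 1)) (P : QOp (Fin n)) : C.Fault := Pi.mulSingle l P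

/-- The product of all the unitary operations with level `l`. -/
def levelUnitary (l : ℕ) : QOp (Fin n) :=
  ((List.finRange C.size).reverse.map fun i =>
    if (C.op i).isMeas = false ∧ C.level i = l then (C.op i).mat else 1).prod

/-- The back-cumulant. Its last component is that of `F`, and going backward its component right
before level `i + 1` is that of `F` multiplied by its component right after level `i + 1` conjugated
by the inverse of the product of the unitaries of that level. -/
def backCumulant (F : C.Fault) : C.Fault := fun l =>
  Fin.reverseInduction (motive := fun _ => QOp (Fin n)) (F (Fin.last C.depth))
    (fun i E => F i.castSucc *
      ((C.levelUnitary (i.val + 1))ᴴ * E * C.levelUnitary (i.val + 1))) l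

/-- The index of the half-integer time right before the operation `i`. -/
def timeBefore (i : Fin C.size) : Fin (C.depth + 1) :=
  ⟨C.level i - 1, by have := C.level_le_depth i; omega⟩

/-- `F(u)`: the product over the measurements `j` of the fault operators with component
`S_j ^ u_j` right before the measurement of `S_j`. -/
def measFault (u : C.Meas → ZMod 2) : C.Fault :=
  ((List.finRange C.size).map fun i =>
    if h : (C.op i).isMeas = true then
      C.eta (C.timeBefore i) ((C.op i).mat ^ (u ⟨i, h⟩).val)
    else 1).prod

/-- The check operator of `u`: the back-cumulant of `F(u)`, as an operator on the
`n (Δ + 1)` space-time qubits. -/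
def checkOperator (u : C.Meas → ZMod 2) : QOp C.STQubit :=
  Fault.toOp (C.backCumulant (C.measFault u))

end CliffordCircuit

end SpacetimeCode

end

open SpacetimeCode

/-!
The proof works in the Heisenberg picture. For a bit-string `u`, propagate the observable
`∏ j, (-1) ^ (u_j o_j)` of the outcomes `o` backward through the operations. A gate conjugates the
propagated operator. Averaging over the outcome of a measurement of `S_j` multiplies it by
`S_j ^ u_j`, up to a factor, if it commutes with `S_j`, and kills it if it anticommutes; these are
the only cases, since the propagated operator is a Pauli operator. If `u` lies in the dual of the
outcome code, then all outcomes that occur have sign `1`, so the final result is `∑ o, K_oᴴ K_o`,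
where `K_o` is the operator applied on outcome `o`, and this does not vanish
(`heisenberg_finRange_ne_zero`). Hence every measured operator commutes with what is propagated
back to it (`heisenberg_eq_smul_backProp`).

The components of the back-cumulant of `F(u)` are the operators propagated back to the
half-integer times (`backCumulant_measFault`). Operations of one level commute, so for `u` in the
dual code these components also commute with the operators measured in the preceding level
(`commute_mat_backProp_opsAfter`). It follows that the check operators of dual codewords multiply
without phases: `u ↦ checkOperator u` is a homomorphism (`checkOperator_add`), whose image is
therefore a commutative group.

A Pauli operator with non-zero trace is a scalar. If the check operator of `u` is a scalar, so are
all of its components, hence so is the product of the `S_j ^ u_j` in each level; as these have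
disjoint supports, `u = 0` (`eq_zero_of_trace_checkOperator_ne_zero`). Thus `-1` is not in the
group, the `2 ^ (m - k)` check operators are distinct, and all but the identity are traceless. The
average of the group is the projection onto the code space, and its trace is
`2 ^ N / 2 ^ (m - k)` (`finrank_codeSpace_range_mul_card`).
-/

namespace SpacetimeCode

/-! ### Tensor products of matrices over a finite index set -/

/-- The tensor product of a family of matrices, on the index set of all choice functions. -/
def piKron {ι α : Type} [Fintype ι] (A : ι → Matrix α α ℂ) : Matrix (ι → α) (ι → α) ℂ :=
  Matrix.of fun x y => ∏ i, A i (x i) (y i)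

section PiKron

variable {ι α : Type} [Fintype ι]

theorem piKron_mul [DecidableEq ι] [Fintype α] (A B : ι → Matrix α α ℂ) :
    piKron A * piKron B = piKron fun i => A i * B i := by
  ext x y
  simp only [piKron, Matrix.mul_apply, Matrix.of_apply, Finset.prod_univ_sum,
    Fintype.piFinset_univ, Finset.prod_mul_distrib]

theorem piKron_one [DecidableEq ι] [DecidableEq α] :
    piKron (fun _ : ι => (1 : Matrix α α ℂ)) = 1 := by
  ext x y
  simp only [piKron, Matrix.of_apply, Matrix.one_apply, Finset.prod_ite_zero, funext_iff]
  simp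

theorem piKron_smul (c : ι → ℂ) (A : ι → Matrix α α ℂ) :
    piKron (fun i => c i • A i) = (∏ i, c i) • piKron A := by
  ext x y
  simp [piKron, Finset.prod_mul_distrib]

theorem conjTranspose_piKron (A : ι → Matrix α α ℂ) :
    (piKron A)ᴴ = piKron fun i => (A i)ᴴ := by
  ext x y
  simp [piKron, Matrix.conjTranspose_apply]

theorem trace_piKron [DecidableEq ι] [Fintype α] (A : ι → Matrix α α ℂ) :
    (piKron A).trace = ∏ i, (A i).trace := by
  simp only [piKron, Matrix.trace, Matrix.diag, Matrix.of_apply, Finset.prod_univ_sum,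
    Fintype.piFinset_univ]

end PiKron

/-! ### The Pauli group -/

namespace Pauli

theorem exists_mul (p q : Pauli) :
    ∃ (a : ℕ) (r : Pauli), p.mat * q.mat = Complex.I ^ a • r.mat := by
  have h3 : Complex.I ^ 3 = -Complex.I := Complex.I_pow_three
  rcases p with _ | _ | _ | _ <;> rcases q with _ | _ | _ | _
  · exact ⟨0, .I, by simp [mat]⟩
  · exact ⟨0, .X, by simp [mat]⟩
  · exact ⟨0, .Y, by simp [mat]⟩
  · exact ⟨0, .Z, by simp [mat]⟩
  · exact ⟨0, .X, by simp [mat]⟩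
  · exact ⟨0, .I, by simp [mat, Matrix.one_fin_two]⟩
  · exact ⟨1, .Z, by simp [mat]⟩
  · exact ⟨3, .Y, by simp [mat, h3]⟩
  · exact ⟨0, .Y, by simp [mat]⟩
  · exact ⟨3, .Z, by simp [mat, h3]⟩
  · exact ⟨0, .I, by simp [mat, Matrix.one_fin_two]⟩
  · exact ⟨1, .X, by simp [mat]⟩
  · exact ⟨0, .Z, by simp [mat]⟩
  · exact ⟨1, .Y, by simp [mat]⟩
  · exact ⟨3, .X, by simp [mat, h3]⟩
  · exact ⟨0, .I, by simp [mat, Matrix.one_fin_two]⟩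

theorem mat_mul_self (p : Pauli) : p.mat * p.mat = 1 := by
  rcases p with _ | _ | _ | _ <;> simp [mat, Matrix.one_fin_two]

theorem conjTranspose_mat (p : Pauli) : p.matᴴ = p.mat := by
  rcases p with _ | _ | _ | _ <;> ext i j <;> fin_cases i <;> fin_cases j <;>
    simp [mat, Matrix.conjTranspose_apply]

theorem trace_mat_of_ne {p : Pauli} (hp : p ≠ .I) : p.mat.trace = 0 := by
  rcases p with _ | _ | _ | _ <;> simp_all [mat, Matrix.trace_fin_two]

theorem exists_commutator_sign (p q : Pauli) :
    ∃ ε : ℂ, (ε = 1 ∨ ε = -1) ∧ p.mat * q.mat = ε • (q.mat * p.mat) := by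
  rcases p with _ | _ | _ | _ <;> rcases q with _ | _ | _ | _ <;>
    solve
    | (refine ⟨1, Or.inl rfl, ?_⟩; simp [mat])
    | (refine ⟨-1, Or.inr rfl, ?_⟩; simp [mat])

theorem exists_anticommute {p : Pauli} (hp : p ≠ .I) :
    ∃ r : Pauli, r.mat * p.mat = (-1 : ℂ) • (p.mat * r.mat) := by
  rcases p with _ | _ | _ | _
  · exact absurd rfl hp
  · exact ⟨.Z, by simp [mat]⟩
  · exact ⟨.X, by simp [mat]⟩
  · exact ⟨.X, by simp [mat]⟩

instance : Finite Pauli :=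
  Finite.of_surjective (fun i : Fin 4 => ![Pauli.I, .X, .Y, .Z] i) fun p => by
    rcases p with _ | _ | _ | _
    exacts [⟨0, rfl⟩, ⟨1, rfl⟩, ⟨2, rfl⟩, ⟨3, rfl⟩]

end Pauli

section PauliGroup

variable {Q : Type} [Fintype Q]

theorem pauliString_eq_piKron (p : Q → Pauli) : pauliString p = piKron fun q => (p q).mat := rfl

theorem conjTranspose_pauliString (p : Q → Pauli) : (pauliString p)ᴴ = pauliString p := by
  simp only [pauliString_eq_piKron, conjTranspose_piKron, Pauli.conjTranspose_mat]

theorem isPauli_pow_smul (a : ℕ) (p : Q → Pauli) : IsPauli (Complex.I ^ a • pauliString p) :=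
  ⟨⟨a % 4, Nat.mod_lt _ (by norm_num)⟩, p, by rw [Complex.I_pow_eq_pow_mod]⟩

theorem finite_setOf_isPauli : {A : QOp Q | IsPauli A}.Finite := by
  refine (Set.finite_range fun x : Fin 4 × (Q → Pauli) =>
    Complex.I ^ (x.1 : ℕ) • pauliString x.2).subset ?_
  rintro A ⟨a, p, rfl⟩
  exact ⟨(a, p), rfl⟩

theorem IsPauliObservable.isPauli {A : QOp Q} (hA : IsPauliObservable A) : IsPauli A := by
  obtain ⟨p, -, rfl | rfl⟩ := hA
  · simpa using isPauli_pow_smul 0 p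
  · simpa using isPauli_pow_smul 2 p

theorem IsPauliObservable.conjTranspose_eq {A : QOp Q} (hA : IsPauliObservable A) : Aᴴ = A := by
  obtain ⟨p, -, rfl | rfl⟩ := hA <;> simp [conjTranspose_pauliString]

variable [DecidableEq Q]

theorem pauliString_mul_self (p : Q → Pauli) : pauliString p * pauliString p = 1 := by
  simp only [pauliString_eq_piKron, piKron_mul, Pauli.mat_mul_self, piKron_one]

theorem pauliString_const_I : pauliString (fun _ : Q => Pauli.I) = 1 := piKron_one

theorem isPauli_one : IsPauli (1 : QOp Q) :=
  ⟨0, fun _ => .I, by simp [pauliString_const_I]⟩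

theorem IsPauli.mul {A B : QOp Q} (hA : IsPauli A) (hB : IsPauli B) : IsPauli (A * B) := by
  obtain ⟨a, p, rfl⟩ := hA
  obtain ⟨b, q, rfl⟩ := hB
  choose c r hr using fun i => Pauli.exists_mul (p i) (q i)
  have h : pauliString p * pauliString q = Complex.I ^ (∑ i, c i) • pauliString r := by
    simp only [pauliString_eq_piKron, piKron_mul, hr, piKron_smul, Finset.prod_pow_eq_pow_sum]
  rw [Matrix.smul_mul, Matrix.mul_smul, h, smul_smul, smul_smul, ← pow_add, ← pow_add]
  exact isPauli_pow_smul _ _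

theorem IsPauli.conjTranspose_mul_self {A : QOp Q} (hA : IsPauli A) : Aᴴ * A = 1 := by
  obtain ⟨a, p, rfl⟩ := hA
  rw [Matrix.conjTranspose_smul, conjTranspose_pauliString, Matrix.smul_mul, Matrix.mul_smul,
    pauliString_mul_self, smul_smul]
  simp [← mul_pow]

theorem IsPauli.mem_unitaryGroup {A : QOp Q} (hA : IsPauli A) :
    A ∈ Matrix.unitaryGroup (Q → Fin 2) ℂ :=
  Matrix.mem_unitaryGroup_iff'.2 hA.conjTranspose_mul_self

theorem IsPauli.commute_or_anticommute {A B : QOp Q} (hA : IsPauli A) (hB : IsPauli B) :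
    A * B = B * A ∨ A * B = -(B * A) := by
  obtain ⟨a, p, rfl⟩ := hA
  obtain ⟨b, q, rfl⟩ := hB
  choose ε hε h using fun i => Pauli.exists_commutator_sign (p i) (q i)
  have hprod : ∏ i, ε i = 1 ∨ ∏ i, ε i = -1 :=
    Finset.prod_induction ε (fun z => z = 1 ∨ z = -1)
      (by rintro _ _ (rfl | rfl) (rfl | rfl) <;> simp) (Or.inl rfl) fun i _ => hε i
  have hpq : pauliString p * pauliString q = (∏ i, ε i) • (pauliString q * pauliString p) := by
    simp only [pauliString_eq_piKron, piKron_mul, h, piKron_smul]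
  simp only [Matrix.smul_mul, Matrix.mul_smul, hpq]
  rcases hprod with h1 | h1 <;> rw [h1]
  · left; rw [one_smul, smul_comm]
  · right; rw [neg_one_smul, smul_neg, smul_neg, smul_comm]

theorem trace_pauliString_of_ne {p : Q → Pauli} {q : Q} (hq : p q ≠ .I) :
    (pauliString p).trace = 0 := by
  rw [pauliString_eq_piKron, trace_piKron]
  exact Finset.prod_eq_zero (Finset.mem_univ q) (Pauli.trace_mat_of_ne hq)

theorem IsPauliObservable.mul_self {A : QOp Q} (hA : IsPauliObservable A) : A * A = 1 := by
  obtain ⟨p, -, rfl | rfl⟩ := hA <;> simp [pauliString_mul_self]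

/-- Conjugation by `U` permutes the finite Pauli group, so conjugation by `Uᴴ` preserves it too. -/
theorem IsClifford.isPauli_conjTranspose_mul_mul {U P : QOp Q} (hU : IsClifford U)
    (hP : IsPauli P) : IsPauli (Uᴴ * P * U) := by
  have hUU : Uᴴ * U = 1 := Matrix.mem_unitaryGroup_iff'.1 hU.1
  have hconj : ∀ A : QOp Q, Uᴴ * (U * A * Uᴴ) * U = A := fun A => by
    calc Uᴴ * (U * A * Uᴴ) * U = (Uᴴ * U) * A * (Uᴴ * U) := by noncomm_ring
      _ = A := by rw [hUU, one_mul, mul_one]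
  have : Finite {A : QOp Q // IsPauli A} := finite_setOf_isPauli
  have hinj : Function.Injective fun A : {A : QOp Q // IsPauli A} =>
      (⟨U * A * Uᴴ, hU.2 A A.2⟩ : {A : QOp Q // IsPauli A}) := fun A B h => by
    refine Subtype.ext ?_
    rw [← hconj A, ← hconj B]
    exact congrArg (fun X => Uᴴ * X * U) (congrArg Subtype.val h)
  obtain ⟨P', hP'⟩ := Finite.surjective_of_injective hinj ⟨P, hP⟩
  have hP'' : U * (P' : QOp Q) * Uᴴ = P := congrArg Subtype.val hP'
  rw [← hP'', hconj]
  exact P'.2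

end PauliGroup

/-! ### Operators with disjoint supports -/

section Support

variable {Q : Type} [DecidableEq Q]

theorem ActsTriviallyOn.apply_piecewise {A : QOp Q} {T : Finset Q}
    (hA : ∀ q ∈ T, ActsTriviallyOn A q) {x y : Q → Fin 2} (hxy : ∀ q ∈ T, x q = y q)
    (w : Q → Fin 2) : A (T.piecewise w x) (T.piecewise w y) = A x y := by
  induction T using Finset.induction_on with
  | empty => simp
  | insert q T hq ih =>
    rw [Finset.piecewise_insert, Finset.piecewise_insert,
      (hA q (Finset.mem_insert_self q T)).2 _ _ (by simp [hq, hxy]) _]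
    exact ih (fun r hr => hA r (Finset.mem_insert_of_mem hr))
      fun r hr => hxy r (Finset.mem_insert_of_mem hr)

omit [DecidableEq Q] in
theorem eq_zero_of_eq_neg {A : QOp Q} (h : A = -A) : A = 0 := by
  ext x y
  exact self_eq_neg.1 (congrFun (congrFun h x) y)

variable [Fintype Q]

theorem actsTriviallyOn_pauliString {p : Q → Pauli} {q : Q} (hp : p q = .I) :
    ActsTriviallyOn (pauliString p) q := by
  refine ⟨fun x y h => Finset.prod_eq_zero (Finset.mem_univ q) ?_, fun x y h b => ?_⟩
  · rw [hp]
    exact Matrix.one_apply_ne h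
  · refine Finset.prod_congr rfl fun i _ => ?_
    by_cases hi : i = q
    · subst hi
      rw [Function.update_self, Function.update_self, hp, h]
      exact (Matrix.one_apply_eq b).trans (Matrix.one_apply_eq (y i)).symm
    · simp [hi]

/-- In `(A * B) x y` only one intermediate index contributes: `x` where `A` acts trivially and `y`
elsewhere. -/
theorem mul_apply_of_actsTriviallyOn {A B : QOp Q} {T : Finset Q}
    (hA : ∀ q ∈ T, ActsTriviallyOn A q) (hB : ∀ q ∉ T, ActsTriviallyOn B q) (x y : Q → Fin 2) :
    (A * B) x y = A x (T.piecewise x y) * B (T.piecewise x y) y := by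
  rw [Matrix.mul_apply]
  refine Finset.sum_eq_single _ (fun z _ hz => ?_) (by simp)
  obtain ⟨q, hq⟩ := Function.ne_iff.1 hz
  by_cases hT : q ∈ T
  · rw [(hA q hT).1 x z (by simpa [hT, eq_comm] using hq), zero_mul]
  · rw [(hB q hT).1 z y (by simpa [hT] using hq), mul_zero]

theorem commute_of_actsTriviallyOn {A B : QOp Q}
    (h : ∀ q, ActsTriviallyOn A q ∨ ActsTriviallyOn B q) : Commute A B := by
  classical
  set T : Finset Q := Finset.univ.filter fun q => ActsTriviallyOn A q with hT
  have hA : ∀ q ∈ T, ActsTriviallyOn A q := fun q hq => by simpa [hT] using hq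
  have hB : ∀ q ∉ T, ActsTriviallyOn B q := fun q hq =>
    (h q).resolve_left (by simpa [hT] using hq)
  ext x y
  rw [mul_apply_of_actsTriviallyOn hA hB,
    mul_apply_of_actsTriviallyOn (T := Tᶜ) (by simpa using hB) (by simpa using hA),
    Finset.piecewise_compl, mul_comm]
  congr 1
  · have := ActsTriviallyOn.apply_piecewise (T := Tᶜ) (by simpa using hB)
      (x := T.piecewise x y) (y := y) (fun q hq => by simp [Finset.mem_compl.1 hq]) x
    rw [← this]
    congr 1
    · ext q; by_cases hq : q ∈ T <;> simp [hq]
    · ext q; by_cases hq : q ∈ T <;> simp [hq]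
  · have := ActsTriviallyOn.apply_piecewise hA
      (x := x) (y := T.piecewise x y) (fun q hq => by simp [hq]) y
    rw [← this]
    congr 1
    ext q; by_cases hq : q ∈ T <;> simp [hq]

theorem commute_of_disjoint_opSupport {A B : QOp Q} (h : Disjoint (opSupport A) (opSupport B)) :
    Commute A B :=
  commute_of_actsTriviallyOn fun q => by
    by_contra! hq
    exact Set.disjoint_left.1 h hq.1 hq.2

/-- A measurable Pauli operator anticommutes with a Pauli operator on a single qubit of its
support; that operator commutes with everything that acts trivially on the qubit. -/
theorem IsPauliObservable.exists_anticommute {S : QOp Q} (hS : IsPauliObservable S) :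
    ∃ q ∈ opSupport S, ∃ R : QOp Q, R * R = 1 ∧ R * S = -(S * R) ∧
      ∀ A, ActsTriviallyOn A q → Commute R A := by
  obtain ⟨p, ⟨q, hq⟩, hSp⟩ := hS
  obtain ⟨r, hr⟩ := Pauli.exists_anticommute hq
  set R : QOp Q := pauliString (Function.update (fun _ => Pauli.I) q r) with hR
  have hRR : R * R = 1 := pauliString_mul_self _
  have hcomm : ∀ A, ActsTriviallyOn A q → Commute R A := fun A hA =>
    commute_of_actsTriviallyOn fun i => by
      by_cases hi : i = q
      · exact Or.inr (hi ▸ hA)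
      · exact Or.inl (actsTriviallyOn_pauliString (by simp [hi]))
  have hp : R * pauliString p = -(pauliString p * R) := by
    have h1 : ∀ i, (Function.update (fun _ => Pauli.I) q r i).mat * (p i).mat =
        (if i = q then (-1 : ℂ) else 1) •
          ((p i).mat * (Function.update (fun _ => Pauli.I) q r i).mat) := fun i => by
      by_cases hi : i = q
      · subst hi; simpa using hr
      · simp [hi, Pauli.mat]
    rw [hR]
    simp only [pauliString_eq_piKron, piKron_mul, h1, piKron_smul]
    simp
  have hRS : R * S = -(S * R) := by
    rcases hSp with rfl | rfl
    · exact hp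
    · rw [mul_neg, hp, neg_mul]
  refine ⟨q, fun htriv => ?_, R, hRR, hRS, hcomm⟩
  have h1 : S * R = -(S * R) := (hcomm S htriv).eq.symm.trans hRS
  have h2 : S * R = 0 := eq_zero_of_eq_neg h1
  have h3 : S = 0 := by
    calc S = S * R * R := by rw [mul_assoc, hRR, mul_one]
      _ = 0 := by rw [h2, zero_mul]
  have h4 : pauliString p = 0 := by
    rcases hSp with h | h
    · rw [← h, h3]
    · rw [← neg_eq_zero, ← h, h3]
  exact one_ne_zero ((pauliString_mul_self p).symm.trans (by rw [h4, zero_mul]))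

end Support

/-! ### Signs of outcomes -/

/-- The sign `(-1) ^ b` of an outcome bit. -/
noncomputable def bitSign (b : ZMod 2) : ℂ := (-1) ^ b.val

theorem bitSign_zero : bitSign 0 = 1 := by simp [bitSign]

theorem bitSign_one : bitSign 1 = -1 := by simp [bitSign, ZMod.val_one]

theorem zmod_two_cases (b : ZMod 2) : b = 0 ∨ b = 1 := by
  fin_cases b
  · exact Or.inl rfl
  · exact Or.inr rfl

theorem bitSign_add (a b : ZMod 2) : bitSign (a + b) = bitSign a * bitSign b := by
  have h11 : (1 : ZMod 2) + 1 = 0 := by decide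
  rcases zmod_two_cases a with rfl | rfl <;> rcases zmod_two_cases b with rfl | rfl <;>
    simp [bitSign_zero, bitSign_one, h11]

theorem bitSign_sum {ι : Type*} (s : Finset ι) (f : ι → ZMod 2) :
    bitSign (∑ i ∈ s, f i) = ∏ i ∈ s, bitSign (f i) := by
  classical
  induction s using Finset.induction_on with
  | empty => simp [bitSign_zero]
  | insert a s ha ih => rw [Finset.sum_insert ha, Finset.prod_insert ha, bitSign_add, ih]

namespace CliffordCircuit

variable {n : ℕ} (C : CliffordCircuit n)

/-! ### Propagating operators backward through the operations of a circuit -/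

/-- `S_i ^ u_i` if operation `i` is the measurement of `S_i`, and `1` if it is a gate. -/
noncomputable def pauliFactor (u : C.Meas → ZMod 2) (i : Fin C.size) : QOp (Fin n) :=
  if h : (C.op i).isMeas = true then (C.op i).mat ^ (u ⟨i, h⟩).val else 1

/-- The unitary of operation `i` if it is a gate, and `1` if it is a measurement. -/
noncomputable def gateFactor (i : Fin C.size) : QOp (Fin n) :=
  if (C.op i).isMeas = false then (C.op i).mat else 1

/-- The product of the `S_i ^ u_i` over the measurements of a chronological list of operations,
each pulled back through the gates that precede it in the list. -/
noncomputable def backProp (u : C.Meas → ZMod 2) : List (Fin C.size) → QOp (Fin n)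
  | [] => 1
  | i :: L => C.pauliFactor u i * ((C.gateFactor i)ᴴ * backProp u L * C.gateFactor i)

theorem isPauliObservable_of_isMeas {i : Fin C.size} (h : (C.op i).isMeas = true) :
    IsPauliObservable (C.op i).mat := by
  cases hop : C.op i with
  | gate U hU => simp [hop, CliffordOp.isMeas] at h
  | meas S hS => exact hS

theorem isClifford_one : IsClifford (1 : QOp (Fin n)) :=
  ⟨one_mem _, fun P hP => by simpa using hP⟩

theorem isClifford_gateFactor (i : Fin C.size) : IsClifford (C.gateFactor i) := by
  unfold gateFactor
  cases hop : C.op i with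
  | gate U hU => simpa [CliffordOp.isMeas, CliffordOp.mat] using hU
  | meas S hS => simpa [CliffordOp.isMeas] using isClifford_one

theorem gateFactor_of_isMeas {i : Fin C.size} (h : (C.op i).isMeas = true) :
    C.gateFactor i = 1 := by
  simp [gateFactor, h]

theorem pauliFactor_of_not_isMeas (u : C.Meas → ZMod 2) {i : Fin C.size}
    (h : ¬ (C.op i).isMeas = true) : C.pauliFactor u i = 1 := by
  simp [pauliFactor, h]

theorem pauliFactor_of_isMeas (u : C.Meas → ZMod 2) {i : Fin C.size}
    (h : (C.op i).isMeas = true) :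
    C.pauliFactor u i = (C.op i).mat ^ (u ⟨i, h⟩).val := by
  simp [pauliFactor, h]

theorem isPauli_pauliFactor (u : C.Meas → ZMod 2) (i : Fin C.size) :
    IsPauli (C.pauliFactor u i) := by
  by_cases h : (C.op i).isMeas = true
  · rw [C.pauliFactor_of_isMeas u h]
    rcases zmod_two_cases (u ⟨i, h⟩) with h0 | h0 <;> rw [h0]
    · simpa using isPauli_one
    · simpa [ZMod.val_one] using (C.isPauliObservable_of_isMeas h).isPauli
  · rw [C.pauliFactor_of_not_isMeas u h]
    exact isPauli_one

theorem conjTranspose_pauliFactor (u : C.Meas → ZMod 2) (i : Fin C.size) :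
    (C.pauliFactor u i)ᴴ = C.pauliFactor u i := by
  by_cases h : (C.op i).isMeas = true
  · rw [C.pauliFactor_of_isMeas u h, Matrix.conjTranspose_pow,
      (C.isPauliObservable_of_isMeas h).conjTranspose_eq]
  · rw [C.pauliFactor_of_not_isMeas u h, Matrix.conjTranspose_one]

theorem isPauli_backProp (u : C.Meas → ZMod 2) (L : List (Fin C.size)) :
    IsPauli (C.backProp u L) := by
  induction L with
  | nil => exact isPauli_one
  | cons i L ih =>
    exact (C.isPauli_pauliFactor u i).mul
      ((C.isClifford_gateFactor i).isPauli_conjTranspose_mul_mul ih)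

/-! ### The Heisenberg picture -/

/-- The sign `(-1) ^ (u_i * o_i)` of a measurement `i`, and `1` for a gate. -/
noncomputable def outcomeSign (u o : C.Meas → ZMod 2) (i : Fin C.size) : ℂ :=
  if h : (C.op i).isMeas = true then bitSign (u ⟨i, h⟩ * o ⟨i, h⟩) else 1

/-- The operator that a chronological list of operations applies when the outcome is `o`. -/
noncomputable def listOp (o : C.Meas → ZMod 2) (L : List (Fin C.size)) : QOp (Fin n) :=
  (L.reverse.map (C.stepOp o)).prod

/-- The Heisenberg-picture observable `∑ o, (-1) ^ (u · o) K_oᴴ K_o` for a list of operations with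
Kraus operators `K_o`. The sum is over the outcomes of all the measurements of the circuit, also
those outside the list, which only contributes a power of two. -/
noncomputable def heisenberg (u : C.Meas → ZMod 2) (L : List (Fin C.size)) : QOp (Fin n) :=
  ∑ o : C.Meas → ZMod 2, (L.map (C.outcomeSign u o)).prod • ((C.listOp o L)ᴴ * C.listOp o L)

theorem listOp_cons (o : C.Meas → ZMod 2) (i : Fin C.size) (L : List (Fin C.size)) :
    C.listOp o (i :: L) = C.listOp o L * C.stepOp o i := by
  simp [listOp]

theorem heisenberg_cons_of_not_isMeas (u : C.Meas → ZMod 2) {i : Fin C.size}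
    (L : List (Fin C.size)) (h : ¬ (C.op i).isMeas = true) :
    C.heisenberg u (i :: L) = (C.gateFactor i)ᴴ * C.heisenberg u L * C.gateFactor i := by
  have hs : ∀ o, C.stepOp o i = C.gateFactor i := fun o => by
    simp [stepOp, gateFactor, h]
  have hw : ∀ o, C.outcomeSign u o i = 1 := fun o => by simp [outcomeSign, h]
  simp only [heisenberg, Matrix.mul_sum, Matrix.sum_mul, List.map_cons, List.prod_cons, hw,
    one_mul, listOp_cons, hs, Matrix.conjTranspose_mul, Matrix.mul_smul, Matrix.smul_mul,
    Matrix.mul_assoc]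

/-- The projector `(1 + (-1) ^ b S) / 2`. -/
noncomputable def eigenProj (S : QOp (Fin n)) (b : ZMod 2) : QOp (Fin n) :=
  (1 / 2 : ℂ) • (1 + bitSign b • S)

theorem conjTranspose_eigenProj {S : QOp (Fin n)} (hS : Sᴴ = S) (b : ZMod 2) :
    (eigenProj S b)ᴴ = eigenProj S b := by
  rcases zmod_two_cases b with rfl | rfl <;>
    simp [eigenProj, bitSign_zero, bitSign_one, hS]

theorem two_smul_heisenberg_cons_of_isMeas (u : C.Meas → ZMod 2) {i : Fin C.size}
    {L : List (Fin C.size)} (hiL : i ∉ L) (h : (C.op i).isMeas = true) :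
    (2 : ℂ) • C.heisenberg u (i :: L) = ∑ b : ZMod 2, bitSign (u ⟨i, h⟩ * b) •
      (eigenProj (C.op i).mat b * C.heisenberg u L * eigenProj (C.op i).mat b) := by
  set e : C.Meas → ZMod 2 := Pi.single ⟨i, h⟩ 1 with he
  set R : (C.Meas → ZMod 2) → QOp (Fin n) := fun o =>
    (L.map (C.outcomeSign u o)).prod • ((C.listOp o L)ᴴ * C.listOp o L) with hR
  set t : (C.Meas → ZMod 2) → ZMod 2 → QOp (Fin n) := fun o b => bitSign (u ⟨i, h⟩ * b) •
      (eigenProj (C.op i).mat b * R o * eigenProj (C.op i).mat b) with ht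
  have hcoord : ∀ o : C.Meas → ZMod 2, ∀ j (hj : (C.op j).isMeas = true), j ∈ L →
      (o + e) ⟨j, hj⟩ = o ⟨j, hj⟩ := fun o j hj hjL => by
    have : (⟨j, hj⟩ : C.Meas) ≠ ⟨i, h⟩ := fun hji =>
      hiL ((Subtype.mk.inj hji : j = i) ▸ hjL)
    simp [he, this]
  -- flipping the outcome of `i` does not change the contribution of the later operations
  have hRe : ∀ o, R (o + e) = R o := fun o => by
    have h1 : L.map (C.outcomeSign u (o + e)) = L.map (C.outcomeSign u o) :=
      List.map_congr_left fun j hj => by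
        unfold outcomeSign
        split_ifs with hm
        · rw [hcoord o j hm hj]
        · rfl
    have h2 : C.listOp (o + e) L = C.listOp o L := by
      unfold listOp
      congr 1
      refine List.map_congr_left fun j hj => ?_
      unfold stepOp
      split_ifs with hm
      · rw [hcoord o j hm (List.mem_reverse.1 hj)]
      · rfl
    simp only [hR, h1, h2]
  have hterm : ∀ o, ((i :: L).map (C.outcomeSign u o)).prod •
      ((C.listOp o (i :: L))ᴴ * C.listOp o (i :: L)) = t o (o ⟨i, h⟩) := fun o => by
    have hs : C.stepOp o i = eigenProj (C.op i).mat (o ⟨i, h⟩) := by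
      simp [stepOp, eigenProj, bitSign, h]
    have hw : C.outcomeSign u o i = bitSign (u ⟨i, h⟩ * o ⟨i, h⟩) := by simp [outcomeSign, h]
    simp only [ht, hR, listOp_cons, hs, List.map_cons, List.prod_cons, hw,
      Matrix.conjTranspose_mul, Matrix.mul_smul, Matrix.smul_mul, smul_smul, Matrix.mul_assoc,
      conjTranspose_eigenProj (C.isPauliObservable_of_isMeas h).conjTranspose_eq]
  have hpair : ∀ o, t o (o ⟨i, h⟩) + t (o + e) ((o + e) ⟨i, h⟩) = ∑ b : ZMod 2, t o b :=
      fun o => by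
    have h11 : (1 : ZMod 2) + 1 = 0 := by decide
    have hsum : ∑ b : ZMod 2, t o b = t o 0 + t o 1 := Fin.sum_univ_two _
    have hte : t (o + e) = t o := by simp only [ht, hRe]
    rw [hsum, hte]
    rcases zmod_two_cases (o ⟨i, h⟩) with h0 | h0
    · simp [he, h0]
    · simp [he, h0, h11, add_comm]
  calc (2 : ℂ) • C.heisenberg u (i :: L)
      = ∑ o, t o (o ⟨i, h⟩) + ∑ o, t (o + e) ((o + e) ⟨i, h⟩) := by
        have hshift : ∑ o, t (o + e) ((o + e) ⟨i, h⟩) = ∑ o, t o (o ⟨i, h⟩) :=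
          Equiv.sum_comp (Equiv.addRight e) fun o => t o (o ⟨i, h⟩)
        rw [hshift, two_smul]
        simp only [heisenberg, hterm]
    _ = ∑ b : ZMod 2, ∑ o, t o b := by
        rw [← Finset.sum_add_distrib, Finset.sum_comm]
        exact Finset.sum_congr rfl fun o _ => hpair o
    _ = _ := by
        refine Finset.sum_congr rfl fun b _ => ?_
        simp only [ht, heisenberg, Matrix.mul_sum, Matrix.sum_mul, Finset.smul_sum, hR]

theorem half_smul_mul_mul_half_smul (S G : QOp (Fin n)) {z : ℂ} (hz : z * z = 1) :
    ((1 / 2 : ℂ) • (1 + z • S)) * G * ((1 / 2 : ℂ) • (1 + z • S)) =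
      (1 / 4 : ℂ) • (G + z • (S * G) + z • (G * S) + S * G * S) := by
  have h : ((1 / 2 : ℂ) • (1 + z • S)) * G * ((1 / 2 : ℂ) • (1 + z • S)) =
      (1 / 4 : ℂ) • (G + z • (S * G) + z • (G * S) + (z * z) • (S * G * S)) := by
    simp only [Matrix.smul_mul, Matrix.mul_smul, add_mul, mul_add, one_mul, mul_one]
    module
  rw [h, hz, one_smul]

theorem sum_eigenProj_of_commute {S G : QOp (Fin n)} (hS : S * S = 1) (h : S * G = G * S)
    (a : ZMod 2) :
    ∑ b : ZMod 2, bitSign (a * b) • (eigenProj S b * G * eigenProj S b) = S ^ a.val * G := by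
  have key : ∀ z : ℂ, z * z = 1 → ((1 / 2 : ℂ) • (1 + z • S)) * G * ((1 / 2 : ℂ) • (1 + z • S)) =
      (1 / 2 : ℂ) • (G + z • (S * G)) := fun z hz => by
    have h1 : S * G * S = G := by rw [h, mul_assoc, hS, mul_one]
    rw [half_smul_mul_mul_half_smul S G hz, h1, ← h]
    module
  have hsum : ∀ f : ZMod 2 → QOp (Fin n), ∑ b, f b = f 0 + f 1 := fun f => Fin.sum_univ_two _
  simp only [eigenProj]
  rw [hsum, key _ (by simp [bitSign_zero]), key _ (by simp [bitSign_one])]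
  rcases zmod_two_cases a with rfl | rfl
  · simp only [zero_mul, bitSign_zero, bitSign_one, ZMod.val_zero, pow_zero, one_mul]
    module
  · simp only [mul_one, mul_zero, bitSign_zero, bitSign_one, ZMod.val_one, pow_one]
    module

theorem eigenProj_mul_mul_of_anticommute {S G : QOp (Fin n)} (hS : S * S = 1)
    (h : S * G = -(G * S)) (b : ZMod 2) : eigenProj S b * G * eigenProj S b = 0 := by
  have key : ∀ z : ℂ, z * z = 1 →
      ((1 / 2 : ℂ) • (1 + z • S)) * G * ((1 / 2 : ℂ) • (1 + z • S)) = 0 := fun z hz => by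
    have h1 : S * G * S = -G := by rw [h, neg_mul, mul_assoc, hS, mul_one]
    rw [half_smul_mul_mul_half_smul S G hz, h1, h]
    module
  refine key _ ?_
  rcases zmod_two_cases b with rfl | rfl <;> simp [bitSign_zero, bitSign_one]

/-- Averaging over the outcome of a measurement kills every operator that anticommutes with it, so
a non-zero Heisenberg-picture observable commutes with each measured operator it meets. -/
theorem heisenberg_eq_smul_backProp (u : C.Meas → ZMod 2) (L : List (Fin C.size))
    (hL : L.Nodup) (hne : C.heisenberg u L ≠ 0) :
    (∃ c : ℂ, C.heisenberg u L = c • C.backProp u L) ∧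
      ∀ A i B, L = A ++ i :: B → (C.op i).isMeas = true →
        (C.op i).mat * C.backProp u B = C.backProp u B * (C.op i).mat := by
  induction L with
  | nil =>
    refine ⟨⟨∑ o : C.Meas → ZMod 2, 1, ?_⟩, by simp⟩
    simp only [heisenberg, backProp, listOp, List.reverse_nil, List.map_nil, List.prod_nil,
      Matrix.conjTranspose_one, mul_one, one_smul, Finset.sum_smul]
  | cons i L ih =>
    obtain ⟨hiL, hL⟩ := List.nodup_cons.1 hL
    by_cases h : (C.op i).isMeas = true
    · have h2 := C.two_smul_heisenberg_cons_of_isMeas u hiL h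
      have hS := (C.isPauliObservable_of_isMeas h)
      have hneL : C.heisenberg u L ≠ 0 := fun h0 => hne <| by
        simpa [h0] using h2
      obtain ⟨⟨c, hc⟩, hcomm⟩ := ih hL hneL
      rw [hc] at h2
      rcases hS.isPauli.commute_or_anticommute (C.isPauli_backProp u L) with hSG | hSG
      · refine ⟨⟨(1 / 2 : ℂ) * c, ?_⟩, ?_⟩
        · have h3 : C.backProp u (i :: L) = (C.op i).mat ^ (u ⟨i, h⟩).val * C.backProp u L := by
            simp [backProp, C.gateFactor_of_isMeas h, C.pauliFactor_of_isMeas u h]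
          rw [h3, ← sum_eigenProj_of_commute hS.mul_self hSG, mul_smul, Finset.smul_sum]
          simp only [Matrix.mul_smul, Matrix.smul_mul] at h2
          have h4 : C.heisenberg u (i :: L) =
              (1 / 2 : ℂ) • ((2 : ℂ) • C.heisenberg u (i :: L)) := by
            rw [smul_smul]; norm_num
          rw [h4, h2]
          exact congrArg _ (Finset.sum_congr rfl fun b _ => smul_comm _ _ _)
        · rintro (_ | ⟨a, A⟩) j B hAB hj
          · obtain ⟨rfl, rfl⟩ := List.cons.inj hAB
            exact hSG
          · exact hcomm A j B (List.cons.inj hAB).2 hj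
      · refine absurd ?_ hne
        simpa [Matrix.mul_smul, Matrix.smul_mul,
          eigenProj_mul_mul_of_anticommute hS.mul_self hSG] using h2
    · have h2 := C.heisenberg_cons_of_not_isMeas u L h
      have hneL : C.heisenberg u L ≠ 0 := fun h0 => hne <| by
        rw [h2, h0, mul_zero, zero_mul]
      obtain ⟨⟨c, hc⟩, hcomm⟩ := ih hL hneL
      refine ⟨⟨c, ?_⟩, ?_⟩
      · rw [h2, hc, backProp, C.pauliFactor_of_not_isMeas u h, one_mul, Matrix.mul_smul,
          Matrix.smul_mul]
      · rintro (_ | ⟨a, A⟩) j B hAB hj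
        · obtain ⟨rfl, rfl⟩ := List.cons.inj hAB
          exact absurd hj h
        · exact hcomm A j B (List.cons.inj hAB).2 hj

/-! ### Dual codewords and measured operators -/

theorem runOp_eq_listOp (o : C.Meas → ZMod 2) : C.runOp o = C.listOp o (List.finRange C.size) :=
  rfl

theorem prod_outcomeSign_finRange (u o : C.Meas → ZMod 2) :
    ((List.finRange C.size).map (C.outcomeSign u o)).prod = bitSign (u ⬝ᵥ o) := by
  rw [← Fin.prod_univ_def, dotProduct, bitSign_sum]
  simp only [outcomeSign, Fintype.prod_dite, Finset.prod_const_one, mul_one]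

/-- The maximally mixed state gives a non-zero probability to every outcome whose Kraus operator
does not vanish. -/
theorem mem_outcomeSet_iff (o : C.Meas → ZMod 2) : o ∈ C.outcomeSet ↔ C.runOp o ≠ 0 := by
  constructor
  · rintro ⟨ρ, -, h⟩ h0
    exact h (by simp [outcomeProb, h0])
  · intro h
    set d : ℂ := (Fintype.card (Fin n → Fin 2) : ℂ) with hd
    have hd0 : d ≠ 0 := Nat.cast_ne_zero.2 Fintype.card_ne_zero
    have hdnn : 0 ≤ d⁻¹ := inv_nonneg.2 (Nat.cast_nonneg _)
    have hps : (d⁻¹ • (1 : QOp (Fin n))).PosSemidef := Matrix.PosSemidef.one.smul hdnn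
    refine ⟨d⁻¹ • 1, ⟨hps, ?_⟩, fun hprob => h ?_⟩
    · rw [Matrix.trace_smul, Matrix.trace_one, smul_eq_mul, inv_mul_cancel₀ hd0]
    · have hnn := (hps.mul_mul_conjTranspose_same (C.runOp o)).trace_nonneg
      have him := (Complex.nonneg_iff.1 hnn).2
      have h0 : (C.runOp o * (d⁻¹ • (1 : QOp (Fin n))) * (C.runOp o)ᴴ).trace = 0 :=
        Complex.ext hprob him.symm
      rw [Matrix.mul_smul, Matrix.smul_mul, mul_one, Matrix.trace_smul, smul_eq_zero] at h0
      exact Matrix.trace_mul_conjTranspose_self_eq_zero_iff.1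
        (h0.resolve_left (inv_ne_zero hd0))

/-- On a dual codeword all the signs `(-1) ^ (u · o)` of the outcomes that occur are `1`, and a sum
of positive semidefinite operators that are not all zero is not zero. -/
theorem heisenberg_finRange_ne_zero {O : Submodule (ZMod 2) (C.Meas → ZMod 2)}
    (hO : (O : Set (C.Meas → ZMod 2)) = C.outcomeSet) {u : C.Meas → ZMod 2}
    (hu : u ∈ dualCode O) : C.heisenberg u (List.finRange C.size) ≠ 0 := by
  have hterm : ∀ o, ((List.finRange C.size).map (C.outcomeSign u o)).prod •
      ((C.listOp o (List.finRange C.size))ᴴ * C.listOp o (List.finRange C.size)) =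
      (C.runOp o)ᴴ * C.runOp o := fun o => by
    rw [prod_outcomeSign_finRange, ← runOp_eq_listOp]
    by_cases ho : o ∈ O
    · rw [hu o ho, bitSign_zero, one_smul]
    · have h0 : C.runOp o = 0 := by
        by_contra h
        exact ho ((Set.ext_iff.1 hO o).2 ((C.mem_outcomeSet_iff o).2 h))
      rw [h0, mul_zero, smul_zero]
  intro h
  have htr := congrArg Matrix.trace h
  simp only [heisenberg, hterm, Matrix.trace_sum, Matrix.trace_zero] at htr
  have h0 := (Finset.sum_eq_zero_iff_of_nonneg fun o _ =>
    (Matrix.posSemidef_conjTranspose_mul_self (C.runOp o)).trace_nonneg).1 htr 0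
      (Finset.mem_univ _)
  exact (C.mem_outcomeSet_iff 0).1 ((Set.ext_iff.1 hO 0).1 O.zero_mem)
    (Matrix.trace_conjTranspose_mul_self_eq_zero_iff.1 h0)

theorem commute_mat_backProp {O : Submodule (ZMod 2) (C.Meas → ZMod 2)}
    (hO : (O : Set (C.Meas → ZMod 2)) = C.outcomeSet) {u : C.Meas → ZMod 2}
    (hu : u ∈ dualCode O) {A B : List (Fin C.size)} {i : Fin C.size}
    (h : List.finRange C.size = A ++ i :: B) (hi : (C.op i).isMeas = true) :
    Commute (C.op i).mat (C.backProp u B) :=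
  (C.heisenberg_eq_smul_backProp u _ (List.nodup_finRange _)
    (C.heisenberg_finRange_ne_zero hO hu)).2 A i B h hi

/-! ### The operations of one level -/

theorem commute_mat_mat {i j : Fin C.size} (hij : i ≠ j) (h : C.level i = C.level j) :
    Commute (C.op i).mat (C.op j).mat :=
  commute_of_disjoint_opSupport (C.disjoint_support i j hij h)

theorem commute_pauliFactor_gateFactor (u : C.Meas → ZMod 2) {i j : Fin C.size}
    (h : C.level i = C.level j) : Commute (C.pauliFactor u i) (C.gateFactor j) := by
  by_cases hi : (C.op i).isMeas = true
  · by_cases hj : (C.op j).isMeas = true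
    · rw [C.gateFactor_of_isMeas hj]
      exact Commute.one_right _
    · have hij : i ≠ j := by rintro rfl; exact hj hi
      rw [C.pauliFactor_of_isMeas u hi, gateFactor, if_pos (by simpa using hj)]
      exact (C.commute_mat_mat hij h).pow_left _
  · rw [C.pauliFactor_of_not_isMeas u hi]
    exact Commute.one_left _

theorem commute_mat_pauliFactor (v : C.Meas → ZMod 2) {i j : Fin C.size}
    (h : C.level i = C.level j) : Commute (C.op i).mat (C.pauliFactor v j) := by
  by_cases hj : (C.op j).isMeas = true
  · rw [C.pauliFactor_of_isMeas v hj]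
    refine Commute.pow_right ?_ _
    by_cases hij : i = j
    · subst hij; exact Commute.refl _
    · exact C.commute_mat_mat hij h
  · rw [C.pauliFactor_of_not_isMeas v hj]
    exact Commute.one_right _

theorem commute_pauliFactor (u v : C.Meas → ZMod 2) {i j : Fin C.size}
    (h : C.level i = C.level j) : Commute (C.pauliFactor u i) (C.pauliFactor v j) := by
  by_cases hi : (C.op i).isMeas = true
  · rw [C.pauliFactor_of_isMeas u hi]
    exact (C.commute_mat_pauliFactor v h).pow_left _
  · rw [C.pauliFactor_of_not_isMeas u hi]
    exact Commute.one_left _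

theorem pauliFactor_one {i : Fin C.size} (hi : (C.op i).isMeas = true) :
    C.pauliFactor 1 i = (C.op i).mat := by
  rw [C.pauliFactor_of_isMeas 1 hi, Pi.one_apply, ZMod.val_one, pow_one]

theorem pauliFactor_add (u v : C.Meas → ZMod 2) (i : Fin C.size) :
    C.pauliFactor (u + v) i = C.pauliFactor u i * C.pauliFactor v i := by
  by_cases hi : (C.op i).isMeas = true
  · have hS := (C.isPauliObservable_of_isMeas hi).mul_self
    have h11 : (1 : ZMod 2) + 1 = 0 := by decide
    simp only [C.pauliFactor_of_isMeas _ hi, Pi.add_apply]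
    rcases zmod_two_cases (u ⟨i, hi⟩) with h1 | h1 <;>
      rcases zmod_two_cases (v ⟨i, hi⟩) with h2 | h2 <;>
      simp [h1, h2, h11, hS, ZMod.val_one]
  · simp [C.pauliFactor_of_not_isMeas _ hi]

/-- The product of the `S_i ^ u_i` over a list of operations. -/
noncomputable def pauliProd (u : C.Meas → ZMod 2) (A : List (Fin C.size)) : QOp (Fin n) :=
  (A.map (C.pauliFactor u)).prod

/-- The product of the gates of a chronological list of operations. -/
noncomputable def gateProd (A : List (Fin C.size)) : QOp (Fin n) :=
  (A.reverse.map C.gateFactor).prod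

theorem pauliProd_cons (u : C.Meas → ZMod 2) (i : Fin C.size) (A : List (Fin C.size)) :
    C.pauliProd u (i :: A) = C.pauliFactor u i * C.pauliProd u A := by
  simp [pauliProd]

theorem gateProd_cons (i : Fin C.size) (A : List (Fin C.size)) :
    C.gateProd (i :: A) = C.gateProd A * C.gateFactor i := by
  simp [gateProd]

theorem isPauli_pauliProd (u : C.Meas → ZMod 2) (A : List (Fin C.size)) :
    IsPauli (C.pauliProd u A) := by
  induction A with
  | nil => exact isPauli_one
  | cons i A ih =>
    rw [pauliProd_cons]
    exact (C.isPauli_pauliFactor u i).mul ih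

theorem gateProd_mem_unitaryGroup (A : List (Fin C.size)) :
    C.gateProd A ∈ Matrix.unitaryGroup (Fin n → Fin 2) ℂ := by
  induction A with
  | nil => exact one_mem _
  | cons i A ih =>
    rw [gateProd_cons]
    exact mul_mem ih (C.isClifford_gateFactor i).1

theorem commute_pauliProd_right {T : QOp (Fin n)} {u : C.Meas → ZMod 2} {A : List (Fin C.size)}
    (h : ∀ i ∈ A, Commute T (C.pauliFactor u i)) : Commute T (C.pauliProd u A) :=
  Commute.list_prod_right _ _ fun x hx => by
    obtain ⟨i, hi, rfl⟩ := List.mem_map.1 hx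
    exact h i hi

theorem commute_gateProd_right {T : QOp (Fin n)} {A : List (Fin C.size)}
    (h : ∀ i ∈ A, Commute T (C.gateFactor i)) : Commute T (C.gateProd A) :=
  Commute.list_prod_right _ _ fun x hx => by
    obtain ⟨i, hi, rfl⟩ := List.mem_map.1 hx
    exact h i (List.mem_reverse.1 hi)

theorem commute_pauliFactor_pauliProd (u v : C.Meas → ZMod 2) {i : Fin C.size}
    {A : List (Fin C.size)} (hA : ∀ j ∈ A, C.level i = C.level j) :
    Commute (C.pauliFactor u i) (C.pauliProd v A) :=
  C.commute_pauliProd_right fun j hj => C.commute_pauliFactor u v (hA j hj)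

theorem pauliProd_add (u v : C.Meas → ZMod 2) {l : ℕ} {A : List (Fin C.size)}
    (hA : ∀ i ∈ A, C.level i = l) :
    C.pauliProd (u + v) A = C.pauliProd u A * C.pauliProd v A := by
  induction A with
  | nil => simp [pauliProd]
  | cons i A ih =>
    have hc : Commute (C.pauliFactor v i) (C.pauliProd u A) :=
      C.commute_pauliFactor_pauliProd v u fun j hj => by
        rw [hA i (by simp), hA j (by simp [hj])]
    rw [pauliProd_cons, pauliProd_cons, pauliProd_cons, ih fun j hj => hA j (by simp [hj]),
      pauliFactor_add, mul_assoc, mul_assoc, ← mul_assoc (C.pauliFactor v i), hc.eq, mul_assoc]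

theorem commute_conjTranspose_right {T G : QOp (Fin n)} (hT : Tᴴ = T) (h : Commute T G) :
    Commute T Gᴴ := by
  have := congrArg Matrix.conjTranspose h.eq
  rw [Matrix.conjTranspose_mul, Matrix.conjTranspose_mul, hT] at this
  exact this.symm

/-- Operations of the same level can be reordered, so propagation through them factors into the
measured operators and the gates. -/
theorem backProp_append (u : C.Meas → ZMod 2) {l : ℕ} {A : List (Fin C.size)}
    (hA : ∀ i ∈ A, C.level i = l) (B : List (Fin C.size)) :
    C.backProp u (A ++ B) =
      C.pauliProd u A * ((C.gateProd A)ᴴ * C.backProp u B * C.gateProd A) := by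
  induction A with
  | nil => simp [pauliProd, gateProd]
  | cons i A ih =>
    have hGP : Commute (C.gateFactor i) (C.pauliProd u A) :=
      C.commute_pauliProd_right fun j hj =>
        (C.commute_pauliFactor_gateFactor u (by rw [hA i (by simp), hA j (by simp [hj])])).symm
    have hGP' : Commute (C.gateFactor i)ᴴ (C.pauliProd u A) :=
      C.commute_pauliProd_right fun j hj =>
        (commute_conjTranspose_right (C.conjTranspose_pauliFactor u j)
          (C.commute_pauliFactor_gateFactor u
            (by rw [hA i (by simp), hA j (by simp [hj])]))).symm
    rw [List.cons_append, backProp, ih fun j hj => hA j (by simp [hj]), pauliProd_cons,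
      gateProd_cons, Matrix.conjTranspose_mul]
    simp only [mul_assoc]
    rw [← mul_assoc (C.gateFactor i)ᴴ (C.pauliProd u A), hGP'.eq, mul_assoc]

/-- Undoes the propagation through a level: `Y` is recovered from `P * (Gᴴ * Y * G)` by operations
with factors that commute with `T`. -/
theorem commute_of_commute_mul_conj {T P G Y : QOp (Fin n)} (hT : Tᴴ = T) (hP : Pᴴ * P = 1)
    (hG : G * Gᴴ = 1) (hTP : Commute T P) (hTG : Commute T G)
    (h : Commute T (P * (Gᴴ * Y * G))) : Commute T Y := by
  have hY : Y = G * (Pᴴ * (P * (Gᴴ * Y * G))) * Gᴴ := by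
    calc Y = (G * Gᴴ) * Y * (G * Gᴴ) := by rw [hG, one_mul, mul_one]
      _ = G * ((1 : QOp (Fin n)) * (Gᴴ * Y * G)) * Gᴴ := by rw [one_mul]; noncomm_ring
      _ = _ := by rw [← hP]; noncomm_ring
  rw [hY]
  exact (hTG.mul_right ((commute_conjTranspose_right hT hTP).mul_right h)).mul_right
    (commute_conjTranspose_right hT hTG)

/-! ### The back-cumulant of the fault operator of a bit-string -/

theorem pairwise_level_finRange :
    (List.finRange C.size).Pairwise fun i j => C.level i ≤ C.level j :=
  (List.pairwise_lt_finRange C.size).imp fun h => C.level_mono h.le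

/-- The operations of level greater than `l`, in chronological order. -/
def opsAfter (l : ℕ) : List (Fin C.size) :=
  (List.finRange C.size).filter fun i => l < C.level i

/-- The operations of level `l`, in chronological order. -/
def opsAt (l : ℕ) : List (Fin C.size) :=
  (List.finRange C.size).filter fun i => C.level i = l

theorem level_of_mem_opsAt {l : ℕ} {i : Fin C.size} (h : i ∈ C.opsAt l) : C.level i = l := by
  simpa [opsAt] using h

theorem filter_level_lt (l : ℕ) {L : List (Fin C.size)}
    (hL : L.Pairwise fun i j => C.level i ≤ C.level j) :
    L.filter (fun i => l < C.level i) =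
      L.filter (fun i => C.level i = l + 1) ++ L.filter fun i => l + 1 < C.level i := by
  induction L with
  | nil => rfl
  | cons a L ih =>
    obtain ⟨ha, hL⟩ := List.pairwise_cons.1 hL
    rcases lt_trichotomy (C.level a) (l + 1) with h | h | h
    · simp [show ¬ l < C.level a by omega, show ¬ C.level a = l + 1 by omega,
        show ¬ l + 1 < C.level a by omega, ih hL]
    · simp [h, ih hL]
    · have h0 : L.filter (fun i => C.level i = l + 1) = [] :=
        List.filter_eq_nil_iff.2 fun i hi => by
          have := ha i hi
          simp; omega
      have h1 := ih hL
      rw [h0, List.nil_append] at h1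
      simp [show l < C.level a by omega, show ¬ C.level a = l + 1 by omega, h, h0, h1]

theorem opsAfter_eq_append (l : ℕ) : C.opsAfter l = C.opsAt (l + 1) ++ C.opsAfter (l + 1) :=
  C.filter_level_lt l C.pairwise_level_finRange

theorem opsAfter_depth : C.opsAfter C.depth = [] :=
  List.filter_eq_nil_iff.2 fun i _ => by
    have := C.level_le_depth i
    simp; omega

theorem prod_map_ite_eq {α : Type*} (L : List α) (p : α → Prop) [DecidablePred p]
    (f : α → QOp (Fin n)) :
    (L.map fun i => if p i then f i else 1).prod = ((L.filter fun i => p i).map f).prod := by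
  induction L with
  | nil => rfl
  | cons a L ih => by_cases h : p a <;> simp [h, ih]

theorem levelUnitary_eq_gateProd (l : ℕ) : C.levelUnitary l = C.gateProd (C.opsAt l) := by
  have h : ∀ i, (if (C.op i).isMeas = false ∧ C.level i = l then (C.op i).mat else 1) =
      if C.level i = l then C.gateFactor i else 1 := fun i => by
    by_cases h1 : (C.op i).isMeas = false <;> by_cases h2 : C.level i = l <;>
      simp [gateFactor, h1, h2]
  rw [levelUnitary, gateProd, opsAt, ← List.filter_reverse, ← prod_map_ite_eq]
  simp only [h]

theorem measFault_apply (u : C.Meas → ZMod 2) (l : Fin (C.depth + 1)) :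
    C.measFault u l = C.pauliProd u (C.opsAt (l + 1)) := by
  have h : ∀ i, (if h : (C.op i).isMeas = true then
      C.eta (C.timeBefore i) ((C.op i).mat ^ (u ⟨i, h⟩).val) else 1) l =
      if C.level i = l + 1 then C.pauliFactor u i else 1 := fun i => by
    have h1 := C.one_le_level i
    have hiff : l = C.timeBefore i ↔ C.level i = l + 1 := by
      rw [Fin.ext_iff, timeBefore]
      simp only
      omega
    by_cases hm : (C.op i).isMeas = true
    · by_cases hl : C.level i = l + 1
      · have := hiff.2 hl
        simp [hm, hl, C.pauliFactor_of_isMeas u hm, eta, ← this]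
      · have : l ≠ C.timeBefore i := fun h => hl (hiff.1 h)
        simp [hm, hl, eta, this]
    · simp [hm, C.pauliFactor_of_not_isMeas u hm]
  rw [pauliProd, opsAt, ← prod_map_ite_eq]
  simp only [← h]
  exact (map_list_prod (Pi.evalMonoidHom (fun _ => QOp (Fin n)) l) _).trans
    (by rw [List.map_map]; rfl)

theorem backCumulant_last (F : C.Fault) :
    C.backCumulant F (Fin.last C.depth) = F (Fin.last C.depth) := by
  simp [backCumulant]

theorem backCumulant_castSucc (F : C.Fault) (l : Fin C.depth) :
    C.backCumulant F l.castSucc = F l.castSucc *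
      ((C.levelUnitary (l + 1))ᴴ * C.backCumulant F l.succ * C.levelUnitary (l + 1)) := by
  simp [backCumulant]

theorem opsAt_depth_succ : C.opsAt (C.depth + 1) = [] :=
  List.filter_eq_nil_iff.2 fun i _ => by
    have := C.level_le_depth i
    simp; omega

theorem backCumulant_measFault (u : C.Meas → ZMod 2) (l : Fin (C.depth + 1)) :
    C.backCumulant (C.measFault u) l = C.backProp u (C.opsAfter l) := by
  induction l using Fin.reverseInduction with
  | last =>
    rw [backCumulant_last, measFault_apply, Fin.val_last, opsAt_depth_succ, opsAfter_depth]
    rfl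
  | cast l ih =>
    rw [backCumulant_castSucc, ih, measFault_apply, levelUnitary_eq_gateProd, Fin.val_castSucc,
      Fin.val_succ, C.opsAfter_eq_append l,
      C.backProp_append u (l := l + 1) fun i hi => C.level_of_mem_opsAt hi]

/-- For a dual codeword, what is propagated back to the end of a level commutes with the operators
measured in that level. -/
theorem commute_mat_backProp_opsAfter {O : Submodule (ZMod 2) (C.Meas → ZMod 2)}
    (hO : (O : Set (C.Meas → ZMod 2)) = C.outcomeSet) {u : C.Meas → ZMod 2}
    (hu : u ∈ dualCode O) {i : Fin C.size} (hi : (C.op i).isMeas = true) :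
    Commute (C.op i).mat (C.backProp u (C.opsAfter (C.level i))) := by
  obtain ⟨A, B, hAB⟩ := List.append_of_mem (List.mem_finRange i)
  have hcomm := C.commute_mat_backProp hO hu hAB hi
  have hpw := C.pairwise_level_finRange
  rw [hAB, List.pairwise_append] at hpw
  obtain ⟨-, hiB, hA⟩ := hpw
  obtain ⟨hiB, hB⟩ := List.pairwise_cons.1 hiB
  obtain ⟨l, hl⟩ : ∃ l, C.level i = l + 1 := ⟨C.level i - 1, by
    have := C.one_le_level i; omega⟩
  -- `B` consists of the rest of the level of `i` and of all the later levels
  have hafter : C.opsAfter (C.level i) = B.filter fun j => l + 1 < C.level j := by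
    have hA0 : A.filter (fun j => l + 1 < C.level j) = [] :=
      List.filter_eq_nil_iff.2 fun j hj => by
        have := hA j hj i (by simp)
        simp; omega
    rw [opsAfter, hAB, hl, List.filter_append, hA0]
    simp [hl]
  have hBall : B.filter (fun j => l < C.level j) = B :=
    List.filter_eq_self.2 fun j hj => by
      have := hiB j hj
      simp; omega
  have hlev : ∀ j ∈ B.filter (fun j => C.level j = l + 1), C.level j = l + 1 := fun j hj => by
    simpa using (List.mem_filter.1 hj).2
  rw [← hBall, C.filter_level_lt l hB, ← hafter, C.backProp_append u hlev] at hcomm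
  refine commute_of_commute_mul_conj (C.isPauliObservable_of_isMeas hi).conjTranspose_eq
    (C.isPauli_pauliProd u _).conjTranspose_mul_self
    (Matrix.mem_unitaryGroup_iff.1 (C.gateProd_mem_unitaryGroup _)) ?_ ?_ hcomm
  · exact C.commute_pauliProd_right fun j hj =>
      C.commute_mat_pauliFactor u (hl.trans (hlev j hj).symm)
  · refine C.commute_gateProd_right fun j hj => ?_
    rw [← C.pauliFactor_one hi]
    exact C.commute_pauliFactor_gateFactor 1 (hl.trans (hlev j hj).symm)

/-- On dual codewords the back-propagated operators multiply without a phase: the factors that have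
to be exchanged commute. -/
theorem backProp_opsAfter_add {O : Submodule (ZMod 2) (C.Meas → ZMod 2)}
    (hO : (O : Set (C.Meas → ZMod 2)) = C.outcomeSet) {u v : C.Meas → ZMod 2}
    (hu : u ∈ dualCode O) (l : Fin (C.depth + 1)) :
    C.backProp (u + v) (C.opsAfter l) =
      C.backProp u (C.opsAfter l) * C.backProp v (C.opsAfter l) := by
  induction l using Fin.reverseInduction with
  | last => simp [opsAfter_depth, backProp]
  | cast l ih =>
    rw [Fin.val_succ] at ih
    set G := C.gateProd (C.opsAt (l + 1)) with hG
    have hlev : ∀ i ∈ C.opsAt (l + 1), C.level i = l + 1 := fun i hi => C.level_of_mem_opsAt hi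
    have hGG : G * Gᴴ = 1 := Matrix.mem_unitaryGroup_iff.1 (C.gateProd_mem_unitaryGroup _)
    have hc : Commute (Gᴴ * C.backProp u (C.opsAfter (l + 1)) * G)
        (C.pauliProd v (C.opsAt (l + 1))) := by
      refine C.commute_pauliProd_right fun i hi => Commute.symm ?_
      have hPG : Commute (C.pauliFactor v i) G := C.commute_gateProd_right fun j hj =>
        C.commute_pauliFactor_gateFactor v ((hlev i hi).trans (hlev j hj).symm)
      have hPX : Commute (C.pauliFactor v i) (C.backProp u (C.opsAfter (l + 1))) := by
        by_cases hm : (C.op i).isMeas = true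
        · rw [C.pauliFactor_of_isMeas v hm, ← hlev i hi]
          exact (C.commute_mat_backProp_opsAfter hO hu hm).pow_left _
        · rw [C.pauliFactor_of_not_isMeas v hm]
          exact Commute.one_left _
      exact ((commute_conjTranspose_right (C.conjTranspose_pauliFactor v i)
        hPG).mul_right hPX).mul_right hPG
    rw [Fin.val_castSucc, opsAfter_eq_append, C.backProp_append _ hlev, C.backProp_append _ hlev,
      C.backProp_append _ hlev, ih, C.pauliProd_add u v hlev, ← hG]
    set P := C.pauliProd u (C.opsAt (l + 1))
    set P' := C.pauliProd v (C.opsAt (l + 1))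
    set X := C.backProp u (C.opsAfter (l + 1))
    set X' := C.backProp v (C.opsAfter (l + 1))
    calc P * P' * (Gᴴ * (X * X') * G)
        = P * P' * (Gᴴ * X * (1 * X') * G) := by rw [one_mul, ← mul_assoc Gᴴ]
      _ = P * (P' * (Gᴴ * X * G)) * (Gᴴ * X' * G) := by rw [← hGG]; simp only [mul_assoc]
      _ = P * (Gᴴ * X * G) * (P' * (Gᴴ * X' * G)) := by rw [← hc.eq]; simp only [mul_assoc]

/-! ### Check operators -/

theorem toOp_eq_submatrix {C : CliffordCircuit n} (F : C.Fault) :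
    Fault.toOp F = (piKron F).submatrix (Equiv.curry _ _ _) (Equiv.curry _ _ _) := rfl

theorem toOp_mul {C : CliffordCircuit n} (F G : C.Fault) :
    Fault.toOp F * Fault.toOp G = Fault.toOp (F * G) := by
  rw [toOp_eq_submatrix, toOp_eq_submatrix, toOp_eq_submatrix, Matrix.submatrix_mul_equiv,
    piKron_mul]
  rfl

theorem toOp_smul_pauliString {C : CliffordCircuit n} (c : Fin (C.depth + 1) → ℂ)
    (p : Fin (C.depth + 1) → Fin n → Pauli) :
    Fault.toOp (C := C) (fun l => c l • pauliString (p l)) =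
      (∏ l, c l) • pauliString fun lq : C.STQubit => p lq.1 lq.2 := by
  ext x y
  simp [Fault.toOp, pauliString, Finset.prod_mul_distrib, Fintype.prod_prod_type]

theorem isPauli_checkOperator (u : C.Meas → ZMod 2) : IsPauli (C.checkOperator u) := by
  have h : ∀ l, IsPauli (C.backCumulant (C.measFault u) l) := fun l => by
    rw [backCumulant_measFault]
    exact C.isPauli_backProp u _
  choose a p hap using h
  rw [checkOperator, funext hap, toOp_smul_pauliString, Finset.prod_pow_eq_pow_sum]
  exact isPauli_pow_smul _ _

theorem checkOperator_add {O : Submodule (ZMod 2) (C.Meas → ZMod 2)}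
    (hO : (O : Set (C.Meas → ZMod 2)) = C.outcomeSet) {u v : C.Meas → ZMod 2}
    (hu : u ∈ dualCode O) :
    C.checkOperator (u + v) = C.checkOperator u * C.checkOperator v := by
  rw [checkOperator, checkOperator, checkOperator, toOp_mul]
  congr 1
  funext l
  rw [Pi.mul_apply, backCumulant_measFault, backCumulant_measFault, backCumulant_measFault,
    C.backProp_opsAfter_add hO hu]

theorem pauliProd_anticommute_of_mem {R : QOp (Fin n)} {u : C.Meas → ZMod 2} {i : Fin C.size}
    {A : List (Fin C.size)} (hA : A.Nodup) (hi : i ∈ A)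
    (hR : R * C.pauliFactor u i = -(C.pauliFactor u i * R))
    (hcomm : ∀ j ∈ A, j ≠ i → Commute R (C.pauliFactor u j)) :
    R * C.pauliProd u A = -(C.pauliProd u A * R) := by
  induction A with
  | nil => simp at hi
  | cons a A ih =>
    obtain ⟨haA, hA⟩ := List.nodup_cons.1 hA
    rw [pauliProd_cons]
    by_cases hai : a = i
    · subst hai
      have hc : Commute R (C.pauliProd u A) := C.commute_pauliProd_right fun j hj =>
        hcomm j (by simp [hj]) (by rintro rfl; exact haA hj)
      rw [← mul_assoc, hR, neg_mul, mul_assoc, hc.eq, mul_assoc]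
    · have h1 := ih hA (by simpa [Ne.symm hai] using hi) fun j hj => hcomm j (by simp [hj])
      rw [← mul_assoc, (hcomm a (by simp) hai).eq, mul_assoc, h1, mul_neg, mul_assoc]

/-- The operators measured in one level have disjoint supports, so a non-trivial product of them is
not a scalar: a Pauli operator on one qubit of one of the supports anticommutes with it. -/
theorem eq_zero_of_pauliProd_eq_smul {u : C.Meas → ZMod 2} {l : ℕ} {c : ℂ}
    (h : C.pauliProd u (C.opsAt l) = c • 1) {i : Fin C.size} (hi : (C.op i).isMeas = true)
    (hl : C.level i = l) : u ⟨i, hi⟩ = 0 := by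
  refine (zmod_two_cases _).resolve_right fun h1 => ?_
  obtain ⟨q, hq, R, hRR, hRS, hR⟩ := (C.isPauliObservable_of_isMeas hi).exists_anticommute
  have hui : C.pauliFactor u i = (C.op i).mat := by
    rw [C.pauliFactor_of_isMeas u hi, h1, ZMod.val_one, pow_one]
  have hanti : R * C.pauliProd u (C.opsAt l) = -(C.pauliProd u (C.opsAt l) * R) := by
    refine C.pauliProd_anticommute_of_mem (i := i) ((List.nodup_finRange _).filter _)
      (by simp [opsAt, hl]) (by rw [hui, hRS]) fun j hj hji => ?_
    by_cases hm : (C.op j).isMeas = true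
    · rw [C.pauliFactor_of_isMeas u hm]
      refine (hR _ ?_).pow_right _
      by_contra hjq
      exact Set.disjoint_left.1 (C.disjoint_support j i hji
        ((C.level_of_mem_opsAt hj).trans hl.symm)) hjq hq
    · rw [C.pauliFactor_of_not_isMeas u hm]
      exact Commute.one_right _
  rw [h, mul_smul_comm, smul_mul_assoc, mul_one, one_mul] at hanti
  have h0 : c • R = 0 := eq_zero_of_eq_neg hanti
  have hP : C.pauliProd u (C.opsAt l) = 0 := by
    rw [h, ← hRR, ← smul_mul_assoc, h0, zero_mul]
  have hone := (C.isPauli_pauliProd u (C.opsAt l)).conjTranspose_mul_self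
  rw [hP, mul_zero] at hone
  exact zero_ne_one hone

/-- A check operator with non-zero trace has only scalar components. Comparing the components before
and after a level, the product of the measured operators of the level is then a scalar as well. -/
theorem eq_zero_of_trace_checkOperator_ne_zero {u : C.Meas → ZMod 2}
    (h : (C.checkOperator u).trace ≠ 0) : u = 0 := by
  have hP : ∀ l, IsPauli (C.backCumulant (C.measFault u) l) := fun l => by
    rw [backCumulant_measFault]
    exact C.isPauli_backProp u _
  choose a p hap using hP
  have hp : ∀ l q, p l q = .I := fun l q => by
    by_contra hne
    refine h ?_
    rw [checkOperator, funext hap, toOp_smul_pauliString, Matrix.trace_smul,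
      trace_pauliString_of_ne (q := (l, q)) hne, smul_zero]
  have hscalar : ∀ l : Fin (C.depth + 1),
      C.backProp u (C.opsAfter l) = Complex.I ^ (a l : ℕ) • 1 := fun l => by
    rw [← backCumulant_measFault, hap l, ← pauliString_const_I]
    congr 2
    exact funext (hp l)
  funext j
  obtain ⟨i, hi⟩ := j
  have h1 := C.one_le_level i
  have h2 := C.level_le_depth i
  obtain ⟨l, hl⟩ : ∃ l, C.level i = l + 1 := ⟨C.level i - 1, by omega⟩
  have hbefore := hscalar ⟨l, by omega⟩
  have hafter := hscalar ⟨l + 1, by omega⟩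
  simp only at hbefore hafter
  have hG : (C.gateProd (C.opsAt (l + 1)))ᴴ * C.gateProd (C.opsAt (l + 1)) = 1 :=
    Matrix.mem_unitaryGroup_iff'.1 (C.gateProd_mem_unitaryGroup _)
  rw [opsAfter_eq_append, C.backProp_append u (l := l + 1) fun i hi => C.level_of_mem_opsAt hi,
    hafter, Matrix.mul_smul, Matrix.smul_mul, mul_one,
    hG, Matrix.mul_smul, mul_one] at hbefore
  refine C.eq_zero_of_pauliProd_eq_smul (l := l + 1) (c := ?_) ?_ hi hl
  · exact (Complex.I ^ (a ⟨l + 1, by omega⟩ : ℕ))⁻¹ * Complex.I ^ (a ⟨l, by omega⟩ : ℕ)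
  · rw [mul_smul, ← hbefore, inv_smul_smul₀ (pow_ne_zero _ Complex.I_ne_zero)]

end CliffordCircuit

/-! ### Dimensions -/

/-- The dual code as a subspace. -/
def dualSubmodule {ι : Type} [Fintype ι] (O : Submodule (ZMod 2) (ι → ZMod 2)) :
    Submodule (ZMod 2) (ι → ZMod 2) where
  carrier := dualCode O
  add_mem' ha hb v hv := by rw [add_dotProduct, ha v hv, hb v hv, add_zero]
  zero_mem' v _ := zero_dotProduct v
  smul_mem' c a ha v hv := by rw [smul_dotProduct, ha v hv, smul_zero]

theorem finrank_add_finrank_dualSubmodule {ι : Type} [Fintype ι]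
    (O : Submodule (ZMod 2) (ι → ZMod 2)) :
    Module.finrank (ZMod 2) O + Module.finrank (ZMod 2) (dualSubmodule O) = Fintype.card ι := by
  classical
  have hmap : (dualSubmodule O).map (dotProductEquiv (ZMod 2) ι).toLinearMap =
      O.dualAnnihilator := by
    ext φ
    rw [Submodule.mem_dualAnnihilator]
    constructor
    · rintro ⟨u, hu, rfl⟩ v hv
      exact hu v hv
    · intro h
      obtain ⟨u, rfl⟩ := (dotProductEquiv (ZMod 2) ι).surjective φ
      exact ⟨u, h, rfl⟩
  rw [← LinearEquiv.finrank_map_eq (dotProductEquiv (ZMod 2) ι) (dualSubmodule O)]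
  have := Subspace.finrank_add_finrank_dualAnnihilator_eq O
  rw [Module.finrank_fintype_fun_eq_card] at this
  rw [← this, ← hmap]

/-- The average of a finite group of unitaries projects onto the vectors it fixes. If all the
non-trivial elements are traceless, the trace of the projection is that of the identity divided
by the order of the group. -/
theorem finrank_codeSpace_range_mul_card {Q D : Type} [Fintype Q] [DecidableEq Q] [Group D]
    [Fintype D] (φ : D →* Matrix.unitaryGroup (Q → Fin 2) ℂ)
    (htr : ∀ d, d ≠ 1 → ((φ d : QOp Q)).trace = 0) :
    Module.finrank ℂ (codeSpace φ.range) * Fintype.card D = 2 ^ Fintype.card Q := by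
  have hD : (Fintype.card D : ℂ) ≠ 0 := Nat.cast_ne_zero.2 Fintype.card_ne_zero
  set P : QOp Q := (Fintype.card D : ℂ)⁻¹ • ∑ d, (φ d : QOp Q) with hP
  have hPmul : ∀ d, (φ d : QOp Q) * P = P := fun d => by
    rw [hP, Matrix.mul_smul, Matrix.mul_sum]
    congr 1
    rw [← Equiv.sum_comp (Equiv.mulLeft d) fun d => (φ d : QOp Q)]
    simp
  have hproj : LinearMap.IsProj (codeSpace φ.range) (Matrix.toLin' P) := by
    constructor
    · rintro ψ g ⟨d, rfl⟩
      rw [Matrix.toLin'_apply, Matrix.mulVec_mulVec, hPmul]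
    · intro ψ hψ
      have h1 : ∀ d, (φ d : QOp Q) *ᵥ ψ = ψ := fun d => hψ _ ⟨d, rfl⟩
      rw [Matrix.toLin'_apply, hP, Matrix.smul_mulVec, Matrix.sum_mulVec]
      simp only [h1, Finset.sum_const, Finset.card_univ]
      rw [← Nat.cast_smul_eq_nsmul ℂ, inv_smul_smul₀ hD]
  have htrace := hproj.trace
  rw [Matrix.trace_toLin'_eq, hP, Matrix.trace_smul, Matrix.trace_sum,
    Finset.sum_eq_single 1 (fun d _ hd => htr d hd) (by simp), map_one] at htrace
  have h1 : ((1 : Matrix.unitaryGroup (Q → Fin 2) ℂ) : QOp Q).trace = 2 ^ Fintype.card Q := by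
    simp
  rw [h1, smul_eq_mul, inv_mul_eq_iff_eq_mul₀ hD] at htrace
  have h2 : ((2 ^ Fintype.card Q : ℕ) : ℂ) =
      ((Module.finrank ℂ (codeSpace φ.range) * Fintype.card D : ℕ) : ℂ) := by
    push_cast
    rw [htrace, mul_comm]
  exact (Nat.cast_injective h2).symm

/-- The homomorphism from the dual code to the spacetime group given by the check operators. -/
noncomputable def checkHom {n : ℕ} (C : CliffordCircuit n)
    (O : Submodule (ZMod 2) (C.Meas → ZMod 2))
    (hO : (O : Set (C.Meas → ZMod 2)) = C.outcomeSet) :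
    Multiplicative (dualSubmodule O) →* Matrix.unitaryGroup (C.STQubit → Fin 2) ℂ :=
  MonoidHom.mk' (fun u => ⟨C.checkOperator u.toAdd, (C.isPauli_checkOperator _).mem_unitaryGroup⟩)
    fun u _ => Subtype.ext (C.checkOperator_add hO u.toAdd.2)

end SpacetimeCode

theorem mainTheorem2 (n : ℕ) (C : CliffordCircuit n)
    (O : Submodule (ZMod 2) (C.Meas → ZMod 2))
    (hO : (O : Set (C.Meas → ZMod 2)) = C.outcomeSet)
    (m k : ℕ) (hm : Fintype.card C.Meas = m) (hk : Module.finrank (ZMod 2) O = k) :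
    ∃ S : Subgroup (Matrix.unitaryGroup (C.STQubit → Fin 2) ℂ),
      (fun g : Matrix.unitaryGroup (C.STQubit → Fin 2) ℂ => (g : QOp C.STQubit)) '' S =
        C.checkOperator '' dualCode O ∧
      IsStabilizerGroup S ∧
      ∃ N K : ℕ, N = n * (C.depth + 1) ∧ (K : ℤ) = (N : ℤ) - ((m : ℤ) - (k : ℤ)) ∧
        HasParameters S N K := by
  set φ := checkHom C O hO with hφ
  have htr : ∀ d, d ≠ 1 → ((φ d : QOp C.STQubit)).trace = 0 := fun d hd => by
    by_contra h
    exact hd (Subtype.ext (C.eq_zero_of_trace_checkOperator_ne_zero h))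
  have hcardQ : Fintype.card C.STQubit = n * (C.depth + 1) := by
    rw [Fintype.card_prod, Fintype.card_fin, Fintype.card_fin, mul_comm]
  refine ⟨φ.range, ?_, ⟨?_, ?_, ?_⟩, n * (C.depth + 1), n * (C.depth + 1) - (m - k), rfl, ?_⟩
  · ext A
    constructor
    · rintro ⟨_, ⟨d, rfl⟩, rfl⟩
      exact ⟨d.toAdd, d.toAdd.2, rfl⟩
    · rintro ⟨u, hu, rfl⟩
      exact ⟨_, ⟨Multiplicative.ofAdd ⟨u, hu⟩, rfl⟩, rfl⟩
  · rintro _ ⟨d, rfl⟩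
    exact C.isPauli_checkOperator _
  · rintro _ ⟨d, rfl⟩ _ ⟨e, rfl⟩
    rw [← map_mul, mul_comm, map_mul]
  · rintro _ ⟨d, rfl⟩ h
    -- `-1` has non-zero trace, so it could only be the check operator of `0`, which is `1`
    by_cases hd : d = 1
    · rw [hd, map_one] at h
      exact one_ne_zero (eq_zero_of_eq_neg h)
    · have := htr d hd
      rw [h, Matrix.trace_neg, Matrix.trace_one, neg_eq_zero] at this
      exact Nat.cast_ne_zero.2 Fintype.card_ne_zero this
  · have hfin := finrank_add_finrank_dualSubmodule O
    rw [hk, hm] at hfin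
    let _ : Fintype (Multiplicative (dualSubmodule O)) := Fintype.ofFinite _
    have hD : Fintype.card (Multiplicative (dualSubmodule O)) = 2 ^ (m - k) := by
      rw [← Nat.card_eq_fintype_card, ← hfin, Nat.add_sub_cancel_left]
      exact (Module.natCard_eq_pow_finrank (K := ZMod 2) (V := dualSubmodule O)).trans (by simp)
    have hdim := finrank_codeSpace_range_mul_card φ htr
    rw [hD, hcardQ] at hdim
    have hle : m - k ≤ n * (C.depth + 1) :=
      (Nat.pow_dvd_pow_iff_le_right (by norm_num)).1 (Dvd.intro_left _ hdim)
    refine ⟨by omega, hcardQ, ?_⟩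
    refine Nat.eq_of_mul_eq_mul_right (pow_pos two_pos (m - k)) ?_
    rw [hdim, ← pow_add, Nat.sub_add_cancel hle]
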